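/- For finite strings $x=x_1\cdots x_n$ and $y=y_1\cdots y_m$ over an alphabet, an \emph{alignment} is a set $A=\{(i_1,j_1),\dots,(i_r,j_r)\}$ with $1\le i_1<\dots<i_r\le n$ and $1\le j_1<\dots<j_r\le m$; its cost is the number of pairs $(i,j)\in A$ with $x_i\ne y_j$, plus the number of $i\in\{1,\dots,n\}$ occurring in no pair of $A$ as first coordinate, plus the number of $j\in\{1,\dots,m\}$ occurring in no pair of $A$ as second coordinate. The edit distance $\Delta_{\mathrm{edit}}(x,y)$ is the minimum cost of an alignment between $x$ and $y$ (insertions, deletions and substitutions each cost $1$). For an infinite string $w=w_1w_2\cdots$ and $i<j$ write $w[i,j)=w_iw_{i+1}\cdots w_{j-1}$. Let $\varepsilon\in(0,1)$. The string $w$ is an \emph{$\varepsilon$-synchronization string} if $\Delta_{\mathrm{edit}}(w[i,j),w[j,k))>(1-\varepsilon)(k-i)$ for all $1\le i<j<k$. It is an \emph{$\varepsilon$-weak synchronization string} if $\Delta_{\mathrm{edit}}(w[i,j),w[j,k))\ge(1-\varepsilon)(k-i)$ for all $1\le i<j<k$ with $k-i\ge\frac1{1-\varepsilon}$. Then there exists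 an infinite $0.999606$-synchronization string over an alphabet of size four, and there exists an infinite $0.995268$-weak synchronization string over the binary alphabet. -/

import Mathlib

/-- An edit distance alignment between a string of length `n` and a string of length `m`:
a set of index pairs `{(i₁, j₁), …, (iₖ, jₖ)}` with `i₁ < ⋯ < iₖ` and `j₁ < ⋯ < jₖ`. -/
def IsAlignment {n m : ℕ} (A : Finset (Fin n × Fin m)) : Prop :=
  ∀ p ∈ A, ∀ q ∈ A, p ≠ q → (p.1 < q.1 ∧ p.2 < q.2) ∨ (q.1 < p.1 ∧ q.2 < p.2)

/-- The cost of an alignment: substitutions plus deletions plus insertions. -/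
def alignmentCost {α : Type*} [DecidableEq α] {n m : ℕ} (x : Fin n → α) (y : Fin m → α)
    (A : Finset (Fin n × Fin m)) : ℕ :=
  (A.filter (fun p => x p.1 ≠ y p.2)).card
    + (Finset.univ.filter (fun i : Fin n => ∀ j : Fin m, (i, j) ∉ A)).card
    + (Finset.univ.filter (fun j : Fin m => ∀ i : Fin n, (i, j) ∉ A)).card

/-- The edit distance of two strings: the least cost of an alignment between them. -/
noncomputable def editDist {α : Type*} [DecidableEq α] {n m : ℕ}
    (x : Fin n → α) (y : Fin m → α) : ℕ :=
  sInf {c : ℕ | ∃ A : Finset (Fin n × Fin m), IsAlignment A ∧ alignmentCost x y A = c}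

/-- The infimum in `editDist` is attained. -/
theorem exists_alignmentCost_eq_editDist {α : Type*} [DecidableEq α] {n m : ℕ}
    (x : Fin n → α) (y : Fin m → α) :
    ∃ A : Finset (Fin n × Fin m), IsAlignment A ∧ alignmentCost x y A = editDist x y :=
  Nat.sInf_mem (s := {c : ℕ | ∃ A : Finset (Fin n × Fin m),
    IsAlignment A ∧ alignmentCost x y A = c}) ⟨_, ∅, by simp [IsAlignment], rfl⟩

/-- The substring `w[i] w[i+1] ⋯ w[j-1]` of an infinite string `w` (used for `i ≤ j`). -/
def factor {α : Type*} (w : ℕ → α) (i j : ℕ) : Fin (j - i) → α :=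
  fun t => w (i + t)

/-- An infinite string is an `ε`-synchronization string if any two consecutive nonempty
substrings `w[i, j)` and `w[j, k)` are at edit distance greater than `(1 - ε) (k - i)`. -/
def IsSynchronizationString {α : Type*} [DecidableEq α] (ε : ℝ) (w : ℕ → α) : Prop :=
  ∀ i j k : ℕ, i < j → j < k →
    (1 - ε) * ((k : ℝ) - (i : ℝ)) < (editDist (factor w i j) (factor w j k) : ℝ)

/-- An infinite string is an `ε`-weak synchronization string if any two consecutive nonempty
substrings `w[i, j)` and `w[j, k)` with `k - i ≥ 1 / (1 - ε)` are at edit distance at least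
`(1 - ε) (k - i)`. -/
def IsWeakSynchronizationString {α : Type*} [DecidableEq α] (ε : ℝ) (w : ℕ → α) : Prop :=
  ∀ i j k : ℕ, i < j → j < k → 1 / (1 - ε) ≤ (k : ℝ) - (i : ℝ) →
    (1 - ε) * ((k : ℝ) - (i : ℝ)) ≤ (editDist (factor w i j) (factor w j k) : ℝ)

/-! Both words carry one free bit in each block of three letters, and the bits are found by
counting. Let s(n) be the number of choices for the first n blocks that keep all long consecutive
factors far apart (`IsSpread`). By strong induction s(n+1) ≥ 1.23 ^ 3 * s(n): of the 2 s(n)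
extensions by one bit, few are spoiled by a close pair of factors ending in the new block.

Such a pair forces most of the second factor to copy the first. The alignment can be recovered from
its unmatched positions, so a spoiled choice is encoded by the bits up to the start of the second
factor, a few positions, the bits there, and the newest bit (`card_close_le`). By the inductive
growth the number of such prefixes is exponentially smaller than s(n) in the length p of the second
factor. This beats the cost of the positions, and the sum over p is small (`card_spreadSets_succ`).
Compactness gives an infinite choice.

In the weak binary case short factors are exempt. With four letters they only have to differ: the
bit decides where a fourth letter is inserted into a ternary square-free word, so every choice is
square-free. -/

open Finset

/-! ### Alignments -/

/-- In an alignment, the two ends of a pair have the same rank. -/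
theorem IsAlignment.card_filter_lt {a p : ℕ} {M : Finset (Fin a × Fin p)} (hM : IsAlignment M)
    {q : Fin a × Fin p} (hq : q ∈ M) :
    #((M.image Prod.fst).filter (· < q.1)) = #((M.image Prod.snd).filter (· < q.2)) := by
  have key : ∀ r ∈ M, ∀ s ∈ M, (r.1 = s.1 ∨ r.2 = s.2) → r = s := by
    intro r hr s hs h
    by_contra hne
    rcases hM r hr s hs hne with h' | h' <;> rcases h with h | h <;> grind
  rw [Finset.filter_image, Finset.filter_image, Finset.card_image_of_injOn,
    Finset.card_image_of_injOn]
  · congr 1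
    apply Finset.filter_congr
    intro r hr
    by_cases h : r = q
    · simp only [h, lt_self_iff_false]
    · rcases hM r hr q hq h with h' | h'
      · simp only [h'.1, h'.2]
      · simp only [h'.1.not_gt, h'.2.not_gt]
  · intro r hr s hs h
    exact key r (Finset.mem_of_mem_filter _ hr) s (Finset.mem_of_mem_filter _ hs) (Or.inr h)
  · intro r hr s hs h
    exact key r (Finset.mem_of_mem_filter _ hr) s (Finset.mem_of_mem_filter _ hs) (Or.inl h)

/-- An alignment is determined by its two projections. -/
theorem IsAlignment.subset_of_image_eq {a p : ℕ} {M N : Finset (Fin a × Fin p)}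
    (hM : IsAlignment M) (hN : IsAlignment N) (h1 : M.image Prod.fst = N.image Prod.fst)
    (h2 : M.image Prod.snd = N.image Prod.snd) : M ⊆ N := by
  intro q hq
  have hq1 : q.1 ∈ N.image Prod.fst := h1 ▸ Finset.mem_image_of_mem _ hq
  obtain ⟨r, hr, hrq⟩ := Finset.mem_image.1 hq1
  have e1 := hM.card_filter_lt hq
  have e2 := hN.card_filter_lt hr
  rw [hrq, ← h1, e1, ← h2] at e2
  have hlt : ∀ s t : Fin p, s ∈ M.image Prod.snd → s < t →
      #((M.image Prod.snd).filter (· < s)) < #((M.image Prod.snd).filter (· < t)) := by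
    intro s t hs hst
    apply Finset.card_lt_card
    refine Finset.ssubset_iff_subset_ne.2 ⟨?_, ?_⟩
    · intro u hu
      simp only [Finset.mem_filter] at hu ⊢
      exact ⟨hu.1, hu.2.trans hst⟩
    · intro h
      have : s ∈ (M.image Prod.snd).filter (· < t) := Finset.mem_filter.2 ⟨hs, hst⟩
      rw [← h] at this
      simp at this
  have hqr : q.2 = r.2 := by
    rcases lt_trichotomy q.2 r.2 with h | h | h
    · exact absurd e2 (hlt _ _ (Finset.mem_image_of_mem _ hq) h).ne
    · exact h
    · exact absurd e2 (hlt _ _ (h2 ▸ Finset.mem_image_of_mem _ hr) h).ne'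
  rwa [show q = r from Prod.ext hrq.symm hqr]

/-- The exact matches of an optimal alignment leave few positions unmatched. -/
theorem exists_matching {α : Type*} [DecidableEq α] {a p : ℕ} (x : Fin a → α) (y : Fin p → α) :
    ∃ M : Finset (Fin a × Fin p), IsAlignment M ∧ (∀ q ∈ M, x q.1 = y q.2) ∧
      #(M.image Prod.fst)ᶜ ≤ editDist x y ∧ #(M.image Prod.snd)ᶜ ≤ editDist x y := by
  obtain ⟨A, hA, hc⟩ := exists_alignmentCost_eq_editDist x y
  refine ⟨A.filter (fun q => x q.1 = y q.2), ?_, ?_, ?_, ?_⟩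
  · intro r hr s hs
    exact hA r (Finset.mem_of_mem_filter _ hr) s (Finset.mem_of_mem_filter _ hs)
  · intro q hq
    exact (Finset.mem_filter.1 hq).2
  · have : ((A.filter (fun q => x q.1 = y q.2)).image Prod.fst)ᶜ ⊆
        (A.filter (fun q => x q.1 ≠ y q.2)).image Prod.fst ∪
          Finset.univ.filter (fun i : Fin a => ∀ j : Fin p, (i, j) ∉ A) := by
      intro i hi
      simp only [mem_compl, mem_image, mem_filter, mem_union, mem_univ, true_and,
        Prod.exists, exists_and_right, exists_eq_right] at hi ⊢
      by_contra! h
      obtain ⟨j, hj⟩ := h.2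
      grind
    have h1 := (Finset.card_le_card this).trans (Finset.card_union_le _ _)
    have h2 := Finset.card_image_le (s := A.filter (fun q => x q.1 ≠ y q.2)) (f := Prod.fst)
    unfold alignmentCost at hc
    omega
  · have : ((A.filter (fun q => x q.1 = y q.2)).image Prod.snd)ᶜ ⊆
        (A.filter (fun q => x q.1 ≠ y q.2)).image Prod.snd ∪
          Finset.univ.filter (fun j : Fin p => ∀ i : Fin a, (i, j) ∉ A) := by
      intro j hj
      simp only [mem_compl, mem_image, mem_filter, mem_union, mem_univ, true_and,
        Prod.exists, exists_eq_right] at hj ⊢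
      by_contra! h
      obtain ⟨i, hi⟩ := h.2
      grind
    have h1 := (Finset.card_le_card this).trans (Finset.card_union_le _ _)
    have h2 := Finset.card_image_le (s := A.filter (fun q => x q.1 ≠ y q.2)) (f := Prod.snd)
    unfold alignmentCost at hc
    omega

theorem IsAlignment.card_image_eq {a p : ℕ} {M : Finset (Fin a × Fin p)} (hM : IsAlignment M) :
    #(M.image Prod.fst) = #(M.image Prod.snd) := by
  rw [Finset.card_image_of_injOn, Finset.card_image_of_injOn]
  all_goals
    intro r hr s hs h
    by_contra hne
    rcases hM r hr s hs hne with h' | h' <;> grind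

/-- The lengths of two strings differ by at most their edit distance. -/
theorem length_le_add_editDist {α : Type*} [DecidableEq α] {a p : ℕ} (x : Fin a → α)
    (y : Fin p → α) : a ≤ p + editDist x y ∧ p ≤ a + editDist x y := by
  obtain ⟨M, hM, -, h1, h2⟩ := exists_matching x y
  have h := hM.card_image_eq
  have e1 := Finset.card_add_card_compl (M.image Prod.fst)
  have e2 := Finset.card_add_card_compl (M.image Prod.snd)
  rw [Fintype.card_fin] at e1 e2
  omega

/-- Two strings at edit distance zero agree. -/
theorem eq_of_editDist_eq_zero {α : Type*} [DecidableEq α] {a p : ℕ} {x : Fin a → α}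
    {y : Fin p → α} (h : editDist x y = 0) (s : ℕ) (hs : s < a) (hs' : s < p) :
    x ⟨s, hs⟩ = y ⟨s, hs'⟩ := by
  obtain ⟨M, hM, hxy, h1, h2⟩ := exists_matching x y
  rw [h, Nat.le_zero, Finset.card_eq_zero, Finset.compl_eq_empty_iff] at h1 h2
  have hs1 : (⟨s, hs⟩ : Fin a) ∈ M.image Prod.fst := by simp [h1]
  obtain ⟨q, hq, hqs⟩ := Finset.mem_image.1 hs1
  have e := hM.card_filter_lt hq
  rw [h1, h2, Finset.filter_gt_eq_Iio, Finset.filter_gt_eq_Iio, Fin.card_Iio, Fin.card_Iio,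
    hqs] at e
  have : q.2 = ⟨s, hs'⟩ := Fin.ext e.symm
  rw [← hqs, ← this]
  exact hxy q hq

/-! ### A square-free ternary word -/

/-- The Thue–Morse sequence. -/
def thueMorse (n : ℕ) : Bool :=
  if h : n = 0 then false else xor (thueMorse (n / 2)) (decide (n % 2 = 1))

theorem thueMorse_two_mul (n : ℕ) : thueMorse (2 * n) = thueMorse n := by
  rcases Nat.eq_zero_or_pos n with rfl | h
  · rfl
  · rw [thueMorse, dif_neg (by omega)]
    simp

theorem thueMorse_two_mul_add_one (n : ℕ) : thueMorse (2 * n + 1) = !thueMorse n := by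
  rw [thueMorse, dif_neg (by omega), show (2 * n + 1) / 2 = n by omega]
  simp [Nat.add_mod]

/-- The Thue–Morse sequence is overlap-free. -/
theorem thueMorse_overlap_free (p : ℕ) : ∀ i : ℕ, 0 < p →
    (∀ s ≤ p, thueMorse (i + s) = thueMorse (i + p + s)) → False := by
  induction p using Nat.strong_induction_on with
  | _ p ih =>
  intro i hp h
  -- An even period descends: positions of the parity of i form an overlap of half the period.
  rcases Nat.even_or_odd' p with ⟨q, rfl | rfl⟩
  · rcases Nat.even_or_odd' i with ⟨m, rfl | rfl⟩
    · refine ih q (by omega) m (by omega) fun s hs => ?_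
      have := h (2 * s) (by omega)
      rwa [← mul_add, ← mul_add, ← mul_add, thueMorse_two_mul, thueMorse_two_mul] at this
    · refine ih q (by omega) m (by omega) fun s hs => ?_
      have := h (2 * s) (by omega)
      rw [show 2 * m + 1 + 2 * s = 2 * (m + s) + 1 by ring,
        show 2 * m + 1 + 2 * q + 2 * s = 2 * (m + q + s) + 1 by ring,
        thueMorse_two_mul_add_one, thueMorse_two_mul_add_one] at this
      simpa using this
  · have pair : ∀ m, m % 2 = 0 → thueMorse (m + 1) = !thueMorse m := by
      intro m hm
      obtain ⟨r, rfl⟩ : ∃ r, m = 2 * r := ⟨m / 2, by omega⟩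
      rw [thueMorse_two_mul_add_one, thueMorse_two_mul]
    -- Letters at 2r and 2r + 1 differ. Shifting by an odd period changes parity, so all neighbours
    -- in the first period differ, and its odd length contradicts periodicity.
    have alt : ∀ s < 2 * q + 1, thueMorse (i + s + 1) = !thueMorse (i + s) := by
      intro s hs
      rcases Nat.mod_two_eq_zero_or_one (i + s) with h0 | h0
      · exact pair _ h0
      · have h1 := h s (by omega)
        have h2 := h (s + 1) (by omega)
        rw [← add_assoc, ← add_assoc, pair (i + (2 * q + 1) + s) (by omega), ← h1] at h2
        exact h2
    have alt2 : ∀ r ≤ q, thueMorse (i + 2 * r) = thueMorse i := by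
      intro r
      induction r with
      | zero => simp
      | succ r ihr =>
        intro hr
        have h1 := alt (2 * r) (by omega)
        have h2 := alt (2 * r + 1) (by omega)
        rw [show i + 2 * (r + 1) = i + (2 * r + 1) + 1 by ring, h2, ← add_assoc, h1,
          ihr (by omega)]
        simp
    have h0 := h 0 (by omega)
    have h1 := alt (2 * q) (by omega)
    rw [alt2 q le_rfl] at h1
    rw [add_zero, add_zero, ← add_assoc, h1] at h0
    simp at h0

/-- The differences of the Thue–Morse sequence, shifted to `{0, 1, 2}`. -/
def ternaryThue (n : ℕ) : Fin 4 :=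
  match thueMorse n, thueMorse (n + 1) with
  | true, false => 0
  | false, true => 2
  | _, _ => 1

theorem ternaryThue_ne_three (n : ℕ) : ternaryThue n ≠ 3 := by
  unfold ternaryThue
  cases thueMorse n <;> cases thueMorse (n + 1) <;> decide

theorem ternaryThue_eq_iff (m n : ℕ) : ternaryThue m = ternaryThue n ↔
    ((thueMorse (m + 1)).toNat : ℤ) - (thueMorse m).toNat
      = (thueMorse (n + 1)).toNat - (thueMorse n).toNat := by
  unfold ternaryThue
  cases thueMorse m <;> cases thueMorse (m + 1) <;> cases thueMorse n <;>
    cases thueMorse (n + 1) <;> decide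

/-- Summing differences turns a square into two Thue–Morse stretches that agree up to a constant.
The values at i, i + p and i + 2p are then an arithmetic progression in {0, 1}, so the constant is
zero and an overlap appears. -/
theorem ternaryThue_square_free (i p : ℕ) (hp : 0 < p)
    (h : ∀ s < p, ternaryThue (i + s) = ternaryThue (i + p + s)) : False := by
  have tele : ∀ s ≤ p, ((thueMorse (i + s)).toNat : ℤ) - (thueMorse i).toNat
      = (thueMorse (i + p + s)).toNat - (thueMorse (i + p)).toNat := by
    intro s
    induction s with
    | zero => simp
    | succ s ihs =>
      intro hs
      have h1 := (ternaryThue_eq_iff _ _).1 (h s (by omega))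
      have h2 := ihs (by omega)
      rw [← add_assoc, ← add_assoc]
      linarith
  have hc := tele p le_rfl
  have hz : thueMorse i = thueMorse (i + p) := by
    revert hc
    cases thueMorse i <;> cases thueMorse (i + p) <;> cases thueMorse (i + p + p) <;> decide
  refine thueMorse_overlap_free p i hp fun s hs => ?_
  have := tele s hs
  rw [hz] at this
  revert this
  cases thueMorse (i + s) <;> cases thueMorse (i + p + s) <;> cases thueMorse (i + p) <;> decide

/-! ### Words with a binary choice in every block of length three -/

/-- The word whose letter at `m` is chosen among `g m false` and `g m true` by the bit `b (m / 3)`. -/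
def choiceWord {α : Type*} (g : ℕ → Bool → α) (b : ℕ → Bool) (m : ℕ) : α := g m (b (m / 3))

/-- A ternary square-free word with one letter `3` inserted into every pair of letters. -/
def insertionChoice (m : ℕ) (c : Bool) : Fin 4 :=
  if m % 3 = 0 then ternaryThue (2 * (m / 3))
  else if (m % 3 = 1) = (c = true) then ternaryThue (2 * (m / 3) + 1) else 3

theorem count_insertionChoice (b : ℕ → Bool) (n : ℕ) :
    Nat.count (fun m => choiceWord insertionChoice b m ≠ 3) (3 * n) = 2 * n := by
  induction n with
  | zero => simp
  | succ n ih =>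
    rw [show 3 * (n + 1) = 3 * n + 1 + 1 + 1 by ring, Nat.count_succ, Nat.count_succ,
      Nat.count_succ, ih]
    cases hb : b n <;>
      simp [choiceWord, insertionChoice, ternaryThue_ne_three, Nat.add_mod,
        show (3 * n + 1) / 3 = n by omega, show (3 * n + 1 + 1) / 3 = n by omega, hb] <;> ring

theorem choiceWord_insertionChoice_of_ne (b : ℕ → Bool) (m : ℕ)
    (h : choiceWord insertionChoice b m ≠ 3) : choiceWord insertionChoice b m =
      ternaryThue (Nat.count (fun m => choiceWord insertionChoice b m ≠ 3) m) := by
  have hc := count_insertionChoice b (m / 3)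
  obtain ⟨n, hn⟩ : ∃ n, m / 3 = n := ⟨_, rfl⟩
  rw [hn] at hc
  have hm : m = 3 * n ∨ m = 3 * n + 1 ∨ m = 3 * n + 1 + 1 := by omega
  rcases hm with rfl | rfl | rfl <;> simp only [Nat.count_succ, hc] <;> revert h <;>
    cases hb : b n <;>
      simp [choiceWord, insertionChoice, ternaryThue_ne_three, Nat.add_mod,
        show (3 * n + 1) / 3 = n by omega, show (3 * n + 1 + 1) / 3 = n by omega, hb]

/-- Deleting the 3s recovers the ternary word, so a square projects to a square there. The
projection is nonempty because no two 3s are adjacent. -/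
theorem choiceWord_insertionChoice_square_free (b : ℕ → Bool) (i p : ℕ) (hp : 0 < p)
    (h : ∀ s < p, choiceWord insertionChoice b (i + s) = choiceWord insertionChoice b (i + p + s)) :
    False := by
  set w := choiceWord insertionChoice b with hw
  have hcount : ∀ s ≤ p, Nat.count (fun m => w m ≠ 3) (i + p + s)
      = Nat.count (fun m => w m ≠ 3) (i + s) + (Nat.count (fun m => w m ≠ 3) (i + p)
        - Nat.count (fun m => w m ≠ 3) i) := by
    intro s
    induction s with
    | zero =>
      have := Nat.count_monotone (fun m => w m ≠ 3) (show i ≤ i + p by omega)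
      intro _
      simp only [add_zero]
      omega
    | succ s ih =>
      intro hs
      have := ih (by omega)
      rw [← add_assoc, ← add_assoc, Nat.count_succ, Nat.count_succ, this, h s (by omega)]
      omega
  refine ternaryThue_square_free (Nat.count (fun m => w m ≠ 3) i)
    (Nat.count (fun m => w m ≠ 3) (i + p) - Nat.count (fun m => w m ≠ 3) i) ?_ ?_
  · by_contra h0
    have hall : ∀ m, i ≤ m → m < i + p → w m = 3 := by
      intro m h1 h2
      by_contra hm
      have e1 := Nat.count_monotone (fun m => w m ≠ 3) h1
      have e2 := Nat.count_monotone (fun m => w m ≠ 3) (show m + 1 ≤ i + p from h2)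
      rw [Nat.count_succ, if_pos hm] at e2
      omega
    have h1 : w i = 3 := hall i le_rfl (by omega)
    -- For p = 1 this letter lies in the second half of the square.
    have h2 : w (i + 1) = 3 := by
      rcases Nat.lt_or_ge 1 p with h' | h'
      · exact hall _ (by omega) (by omega)
      · obtain rfl : p = 1 := by omega
        rw [← h1]
        exact (h 0 (by omega)).symm
    have hn : i = 3 * (i / 3) ∨ i = 3 * (i / 3) + 1 ∨ i = 3 * (i / 3) + 2 := by omega
    obtain ⟨n, hn'⟩ : ∃ n, i / 3 = n := ⟨_, rfl⟩
    rw [hn'] at hn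
    rw [hw] at h1 h2
    rcases hn with rfl | rfl | rfl
    · simp [choiceWord, insertionChoice, ternaryThue_ne_three] at h1
    · revert h1 h2
      cases hb : b n <;>
        simp [choiceWord, insertionChoice, ternaryThue_ne_three, Nat.add_mod,
          show (3 * n + 1) / 3 = n by omega, show (3 * n + 1 + 1) / 3 = n by omega, hb]
    · simp [choiceWord, insertionChoice, ternaryThue_ne_three, add_assoc] at h2
  · intro r hr
    have hex : ∃ s < p, w (i + s) ≠ 3 ∧
        Nat.count (fun m => w m ≠ 3) (i + s) = Nat.count (fun m => w m ≠ 3) i + r := by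
      have hcard : Nat.count (fun m => w m ≠ 3) i + r < Nat.count (fun m => w m ≠ 3) (i + p) := by
        omega
      refine ⟨Nat.nth (fun m => w m ≠ 3) (Nat.count (fun m => w m ≠ 3) i + r) - i, ?_, ?_⟩
      · have := Nat.nth_lt_of_lt_count hcard
        omega
      · have hge : i ≤ Nat.nth (fun m => w m ≠ 3) (Nat.count (fun m => w m ≠ 3) i + r) := by
          by_contra! hlt
          have := Nat.count_monotone (fun m => w m ≠ 3) (Nat.succ_le_of_lt hlt)
          rw [Nat.count_succ, Nat.count_nth, if_pos] at this
          · omega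
          · exact Nat.nth_mem _ fun hf => hcard.trans_le (Nat.count_le_card hf _)
          · exact fun hf => hcard.trans_le (Nat.count_le_card hf _)
        rw [Nat.add_sub_cancel' hge]
        refine ⟨?_, ?_⟩
        · exact Nat.nth_mem _ fun hf => hcard.trans_le (Nat.count_le_card hf _)
        · exact Nat.count_nth fun hf => hcard.trans_le (Nat.count_le_card hf _)
    obtain ⟨s, hs, hs3, hsr⟩ := hex
    have e1 := choiceWord_insertionChoice_of_ne b (i + s) hs3
    have e2 := choiceWord_insertionChoice_of_ne b (i + p + s) (by rwa [← hw, ← h s hs])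
    rw [← hw] at e1 e2
    rw [hcount s hs.le, hsr] at e2
    rw [hsr] at e1
    rw [← e1, h s hs, e2]
    congr 1
    omega

/-! ### Spread words and their finite choices -/

theorem factor_congr {α : Type*} {w w' : ℕ → α} {j : ℕ} (h : ∀ m < j, w m = w' m) (i : ℕ) :
    factor w i j = factor w' i j := by
  funext t
  exact h _ (by have := t.2; omega)

/-- Any two consecutive factors of `w` within its first `m` letters, of total length at least `212`,
are at edit distance at least `1 / 211` of their total length. -/
def IsSpread {α : Type*} [DecidableEq α] (w : ℕ → α) (m : ℕ) : Prop :=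
  ∀ i j k : ℕ, i < j → j < k → k ≤ m → 212 ≤ k - i →
    k - i ≤ 211 * editDist (factor w i j) (factor w j k)

theorem IsSpread.congr {α : Type*} [DecidableEq α] {w w' : ℕ → α} {m : ℕ} (hw : IsSpread w m)
    (h : ∀ s < m, w s = w' s) : IsSpread w' m := by
  intro i j k hij hjk hk hl
  rw [← factor_congr (fun s hs => h s (by omega)) i, ← factor_congr (fun s hs => h s (by omega)) j]
  exact hw i j k hij hjk hk hl

theorem IsSpread.mono {α : Type*} [DecidableEq α] {w : ℕ → α} {m n : ℕ} (hw : IsSpread w n)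
    (h : m ≤ n) : IsSpread w m :=
  fun i j k hij hjk hk hl => hw i j k hij hjk (hk.trans h) hl

/-- The word whose choices are `true` exactly in the blocks from `B`. -/
def setWord {α : Type*} (g : ℕ → Bool → α) (B : Finset ℕ) : ℕ → α :=
  choiceWord g fun t => decide (t ∈ B)

theorem setWord_filter {α : Type*} (g : ℕ → Bool → α) (B : Finset ℕ) {t m : ℕ} (h : m < 3 * t) :
    setWord g (B.filter (· < t)) m = setWord g B m := by
  unfold setWord choiceWord
  congr 1
  simp [show m / 3 < t by omega]

open Classical in
/-- The choices for the first `n` blocks that give a spread word. -/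
noncomputable def spreadSets {α : Type*} [DecidableEq α] (g : ℕ → Bool → α) (n : ℕ) :
    Finset (Finset ℕ) :=
  (range n).powerset.filter fun B => IsSpread (setWord g B) (3 * n)

theorem mem_spreadSets {α : Type*} [DecidableEq α] {g : ℕ → Bool → α} {n : ℕ} {B : Finset ℕ} :
    B ∈ spreadSets g n ↔ B ⊆ range n ∧ IsSpread (setWord g B) (3 * n) := by
  classical
  unfold spreadSets
  rw [Finset.mem_filter, Finset.mem_powerset]

theorem filter_mem_spreadSets {α : Type*} [DecidableEq α] {g : ℕ → Bool → α} {n t : ℕ}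
    {B : Finset ℕ} (hB : IsSpread (setWord g B) (3 * n)) (h : t ≤ n) :
    B.filter (· < t) ∈ spreadSets g t := by
  refine mem_spreadSets.2 ⟨?_, ?_⟩
  · intro s hs
    exact Finset.mem_range.2 (Finset.mem_filter.1 hs).2
  · exact (hB.mono (by omega)).congr fun s hs => (setWord_filter g B hs).symm

/-! ### Encoding choices that produce close factors -/

/-- Weighting each set by 100 ^ (d - #J) ≥ 1 reduces the sum to the binomial theorem. -/
theorem sum_pow_card_le (p d : ℕ) {c : ℝ} (hc : 0 ≤ c) :
    ∑ J : Finset (Fin p) with #J ≤ d, c ^ #J ≤ (1 + c / 100) ^ p * 100 ^ d := by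
  have h := Fintype.sum_pow_mul_eq_add_pow (Fin p) (c / 100) 1
  simp only [one_pow, mul_one, Fintype.card_fin] at h
  rw [add_comm, ← h, Finset.sum_mul]
  refine (Finset.sum_le_sum fun J hJ => ?_).trans
    (Finset.sum_le_sum_of_subset_of_nonneg (Finset.filter_subset _ _) fun J _ _ => by positivity)
  rw [div_pow, div_mul_eq_mul_div, le_div_iff₀ (by positivity)]
  have := pow_le_pow_right₀ (show (1 : ℝ) ≤ 100 by norm_num) (Finset.mem_filter.1 hJ).2
  gcongr

/-- A choice of blocks giving close factors is determined by the choices before the second factor,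
the unmatched positions, the choices at these, and the last choice. -/
theorem card_close_le {α : Type*} [DecidableEq α] {g : ℕ → Bool → α}
    (hg : ∀ t, ∃ m, m / 3 = t ∧ g m false ≠ g m true) {n i j k d : ℕ} (hk : 3 * n < k)
    (hj : j / 3 + 1 ≤ n) {S F : Finset (Finset ℕ)}
    (hF : ∀ B ∈ F, B ⊆ range (n + 1) ∧ B.filter (· < j / 3 + 1) ∈ S ∧
      editDist (factor (setWord g B) i j) (factor (setWord g B) j k) ≤ d) :
    #F ≤ #S * (#{I : Finset (Fin (j - i)) | #I ≤ d} *
      ∑ J : Finset (Fin (k - j)) with #J ≤ d, 2 ^ #J) * 2 := by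
  choose M hM hxy h1 h2 using fun B : Finset ℕ =>
    exists_matching (factor (setWord g B) i j) (factor (setWord g B) j k)
  let T : Finset (Finset ℕ × (Finset (Fin (j - i)) ×
      (Σ _ : Finset (Fin (k - j)), Finset (Fin (k - j)))) × Bool) :=
    S ×ˢ ((univ.filter fun I => #I ≤ d) ×ˢ
      ((univ.filter fun J => #J ≤ d).sigma fun J => J.powerset)) ×ˢ univ
  have hT : #T = #S * (#{I : Finset (Fin (j - i)) | #I ≤ d} *
      ∑ J : Finset (Fin (k - j)) with #J ≤ d, 2 ^ #J) * 2 := by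
    simp only [T, Finset.card_product, Finset.card_sigma, Finset.card_powerset, Finset.card_univ,
      Fintype.card_bool, mul_assoc]
  rw [← hT]
  refine Finset.card_le_card_of_injOn (fun B => (B.filter (· < j / 3 + 1),
    (((M B).image Prod.fst)ᶜ, ⟨((M B).image Prod.snd)ᶜ, ((M B).image Prod.snd)ᶜ.filter
      fun s => (j + s) / 3 ∈ B⟩), decide (n ∈ B))) ?_ ?_
  · intro B hB
    obtain ⟨-, hS, hd⟩ := hF B hB
    simp only [T, Finset.coe_product, Set.mem_prod, Finset.mem_coe, Finset.mem_sigma,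
      Finset.mem_powerset, Finset.mem_filter, Finset.mem_univ, true_and, and_true]
    exact ⟨hS, (h1 B).trans hd, (h2 B).trans hd, Finset.filter_subset _ _⟩
  · intro B hB C hC h
    simp only [Prod.mk.injEq, Sigma.mk.injEq, heq_eq_eq, compl_inj_iff, decide_eq_decide] at h
    obtain ⟨hpre, ⟨hI, hJ, hK⟩, hn⟩ := h
    have hsub := (hM B).subset_of_image_eq (hM C) hI hJ
    have hlow : ∀ t ≤ j / 3, (t ∈ B ↔ t ∈ C) := by
      intro t ht
      have := Finset.ext_iff.1 hpre t
      simp only [Finset.mem_filter] at this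
      constructor <;> intro h <;> [exact (this.1 ⟨h, by omega⟩).1; exact (this.2 ⟨h, by omega⟩).1]
    ext t
    rcases Nat.lt_or_ge (j / 3) t with ht | ht
    swap
    · exact hlow t ht
    rcases lt_trichotomy t n with htn | rfl | htn
    · obtain ⟨m, rfl, hm⟩ := hg t
      have hjm : j ≤ m := by omega
      have hs : m - j < k - j := by omega
      -- A matched position copies a letter of the first factor, which the prefix determines, and
      -- that letter reveals the bit. At an unmatched position the bit is recorded.
      by_cases hmJ : (⟨m - j, hs⟩ : Fin (k - j)) ∈ (M B).image Prod.snd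
      · obtain ⟨q, hq, hqm⟩ := Finset.mem_image.1 hmJ
        have e1 := hxy B q hq
        have e2 := hxy C q (hsub hq)
        have e3 : factor (setWord g B) i j = factor (setWord g C) i j := by
          refine factor_congr (fun s hs => ?_) i
          unfold setWord choiceWord
          congr 1
          simpa using hlow (s / 3) (by omega)
        rw [← e3, e1, hqm] at e2
        simp only [factor, setWord, choiceWord, Nat.add_sub_cancel' hjm] at e2
        by_cases hB' : m / 3 ∈ B <;> by_cases hC' : m / 3 ∈ C <;> simp [hB', hC'] at e2 ⊢
        · exact hm e2.symm
        · exact hm e2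
      · have := Finset.ext_iff.1 hK ⟨m - j, hs⟩
        rw [← hJ] at this
        simpa only [Finset.mem_filter, Finset.mem_compl, hmJ, not_false_eq_true, true_and,
          Nat.add_sub_cancel' hjm] using this
    -- The letter revealing the last bit may lie beyond k, so this bit is recorded separately.
    · exact hn
    · have hB' : t ∉ B := fun h => by have := Finset.mem_range.1 ((hF B hB).1 h); omega
      have hC' : t ∉ C := fun h => by have := Finset.mem_range.1 ((hF C hC).1 h); omega
      simp [hB', hC']

/-- The count of `card_close_le` when both factors have length close to `p`. -/
theorem card_close_le_pow {α : Type*} [DecidableEq α] {g : ℕ → Bool → α}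
    (hg : ∀ t, ∃ m, m / 3 = t ∧ g m false ≠ g m true) {n i j k d : ℕ} (hk : 3 * n < k)
    (hj : j / 3 + 1 ≤ n) (hi : j - i ≤ k - j + d) {S F : Finset (Finset ℕ)}
    (hF : ∀ B ∈ F, B ⊆ range (n + 1) ∧ B.filter (· < j / 3 + 1) ∈ S ∧
      editDist (factor (setWord g B) i j) (factor (setWord g B) j k) ≤ d) :
    (#F : ℝ) ≤ 2 * #S * ((1.0302 : ℝ) ^ (k - j) * 10100 ^ d) := by
  have h := card_close_le hg hk hj hF
  have h1 := sum_pow_card_le (j - i) d (zero_le_one' ℝ)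
  have h2 := sum_pow_card_le (k - j) d (zero_le_two (α := ℝ))
  simp only [one_pow, Finset.sum_const, nsmul_eq_mul, mul_one] at h1
  have h3 : (1 + 1 / 100 : ℝ) ^ (j - i) ≤ (1 + 1 / 100) ^ (k - j + d) :=
    pow_le_pow_right₀ (by norm_num) hi
  calc (#F : ℝ) ≤ #S * (#{I : Finset (Fin (j - i)) | #I ≤ d} *
      ∑ J : Finset (Fin (k - j)) with #J ≤ d, 2 ^ #J) * 2 := by exact_mod_cast h
    _ ≤ #S * (((1 + 1 / 100) ^ (k - j + d) * 100 ^ d) * ((1 + 2 / 100) ^ (k - j) * 100 ^ d)) * 2 := by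
        gcongr
        exact h1.trans (by gcongr)
    _ = 2 * #S * ((1.0302 : ℝ) ^ (k - j) * 10100 ^ d) := by
        rw [show (1.0302 : ℝ) = (1 + 1 / 100) * (1 + 2 / 100) by norm_num,
          show (10100 : ℝ) = (1 + 1 / 100) * 100 * 100 by norm_num, mul_pow, mul_pow, mul_pow,
          pow_add]
        ring_nf

/-! ### Exponential growth of the number of spread choices -/

theorem two_mul_add_one_le_three_pow (d : ℕ) : 2 * d + 1 ≤ 3 ^ d := by
  induction d with
  | zero => simp
  | succ d ih => rw [pow_succ]; omega

/-- The number of admissible choices grows at least by the factor `1.23 ^ 3` with every block. -/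
theorem card_spreadSets_succ {α : Type*} [DecidableEq α] {g : ℕ → Bool → α}
    (hg : ∀ t, ∃ m, m / 3 = t ∧ g m false ≠ g m true) (n : ℕ) :
    (1.23 : ℝ) ^ 3 * #(spreadSets g n) ≤ #(spreadSets g (n + 1)) := by
  classical
  induction n using Nat.strong_induction_on with
  | _ n ih =>
  have hmono : ∀ e t, t + e = n → (1.23 : ℝ) ^ (3 * e) * #(spreadSets g t) ≤ #(spreadSets g n) := by
    intro e
    induction e with
    | zero => rintro t rfl; simp
    | succ e ihe =>
      intro t ht
      have h1 := ih t (by omega)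
      have h2 := ihe (t + 1) (by omega)
      calc (1.23 : ℝ) ^ (3 * (e + 1)) * #(spreadSets g t)
          = 1.23 ^ (3 * e) * (1.23 ^ 3 * #(spreadSets g t)) := by ring
        _ ≤ 1.23 ^ (3 * e) * #(spreadSets g (t + 1)) := by gcongr
        _ ≤ _ := h2
  let E : Finset (Finset ℕ) := spreadSets g n ∪ (spreadSets g n).image (insert n)
  have hE_mem : ∀ B ∈ E, B ⊆ range (n + 1) ∧ IsSpread (setWord g B) (3 * n) := by
    intro B hB
    rcases Finset.mem_union.1 hB with h | h
    · obtain ⟨h1, h2⟩ := mem_spreadSets.1 h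
      exact ⟨h1.trans (Finset.range_subset_range.2 (by omega)), h2⟩
    · obtain ⟨C, hC, rfl⟩ := Finset.mem_image.1 h
      obtain ⟨h1, h2⟩ := mem_spreadSets.1 hC
      refine ⟨?_, h2.congr fun s hs => ?_⟩
      · rw [Finset.range_add_one]
        exact Finset.insert_subset_insert _ h1
      · unfold setWord choiceWord
        congr 1
        simp [show s / 3 ≠ n by omega]
  have hn_notMem : ∀ C ∈ spreadSets g n, n ∉ C := by
    intro C hC h
    have := (mem_spreadSets.1 hC).1 h
    simp at this
  have hE : #E = 2 * #(spreadSets g n) := by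
    rw [Finset.card_union_of_disjoint, Finset.card_image_of_injOn]
    · ring
    · intro C hC D hD h
      rw [← Finset.erase_insert (hn_notMem C hC), ← Finset.erase_insert (hn_notMem D hD)]
      exact congrArg (fun s => Finset.erase s n) h
    · rw [Finset.disjoint_left]
      intro C hC h
      obtain ⟨D, -, rfl⟩ := Finset.mem_image.1 h
      exact hn_notMem _ hC (Finset.mem_insert_self _ _)
  let bad (k p a : ℕ) : Finset (Finset ℕ) := E.filter fun B =>
    editDist (factor (setWord g B) (k - p - a) (k - p)) (factor (setWord g B) (k - p) k) ≤ p / 105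
  let K := Finset.Icc (3 * n + 1) (3 * n + 3)
  -- For factor lengths a, p and distance d, failure means 211 d < a + p ≤ 2p + d, so d ≤ p / 105.
  -- Together with a + p ≥ 212 this also gives p ≥ 106.
  have hcover : E ⊆ spreadSets g (n + 1) ∪ K.biUnion fun k => (Finset.Ico 106 (k + 1)).biUnion
      fun p => (Finset.Icc (p - p / 105) (p + p / 105)).biUnion (bad k p) := by
    intro B hB
    obtain ⟨hB1, hB2⟩ := hE_mem B hB
    by_cases hgood : IsSpread (setWord g B) (3 * (n + 1))
    · exact Finset.mem_union_left _ (mem_spreadSets.2 ⟨hB1, hgood⟩)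
    · apply Finset.mem_union_right
      unfold IsSpread at hgood
      push Not at hgood
      obtain ⟨i, j, k, hij, hjk, hk, hl, hbad⟩ := hgood
      have hk' : 3 * n < k := by
        by_contra! hk'
        exact absurd (hB2 i j k hij hjk hk' hl) (by omega)
      have hlen := length_le_add_editDist (factor (setWord g B) i j) (factor (setWord g B) j k)
      simp only [Finset.mem_biUnion]
      refine ⟨k, Finset.mem_Icc.2 (by omega), k - j, Finset.mem_Ico.2 (by omega), j - i,
        Finset.mem_Icc.2 (by omega), Finset.mem_filter.2 ⟨hB, ?_⟩⟩
      rw [show k - (k - j) = j by omega, show j - (j - i) = i by omega]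
      omega
  have hbad : ∀ k ∈ K, ∀ p ∈ Finset.Ico 106 (k + 1), ∀ a ∈ Finset.Icc (p - p / 105) (p + p / 105),
      (#(bad k p a) : ℝ) ≤ 2 * (1.23 ^ 6 / 1.23 ^ p * #(spreadSets g n)) *
        (1.0302 ^ p * 10100 ^ (p / 105)) := by
    intro k hk p hp a ha
    rw [Finset.mem_Icc] at hk ha
    rw [Finset.mem_Ico] at hp
    have hkp : k - (k - p) = p := by omega
    have h := card_close_le_pow hg (n := n) (i := k - p - a) (j := k - p) (k := k) (d := p / 105)
      (by omega) (by omega) (by omega) (S := spreadSets g ((k - p) / 3 + 1)) (F := bad k p a) ?_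
    · rw [hkp] at h
      refine h.trans ?_
      have h1 := hmono (n - ((k - p) / 3 + 1)) ((k - p) / 3 + 1) (by omega)
      -- Rounding at the two ends, to blocks of three letters, loses at most six letters.
      have h2 : (1.23 : ℝ) ^ p ≤ 1.23 ^ 6 * 1.23 ^ (3 * (n - ((k - p) / 3 + 1))) := by
        rw [← pow_add]
        exact pow_le_pow_right₀ (by norm_num) (by omega)
      gcongr
      rw [div_mul_eq_mul_div, le_div_iff₀ (by positivity)]
      calc (#(spreadSets g ((k - p) / 3 + 1)) : ℝ) * 1.23 ^ p
          ≤ #(spreadSets g ((k - p) / 3 + 1)) *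
            (1.23 ^ 6 * 1.23 ^ (3 * (n - ((k - p) / 3 + 1)))) := by gcongr
        _ = 1.23 ^ 6 * (1.23 ^ (3 * (n - ((k - p) / 3 + 1))) *
            #(spreadSets g ((k - p) / 3 + 1))) := by ring
        _ ≤ _ := by gcongr
    · intro B hB
      obtain ⟨hB1, hB2⟩ := Finset.mem_filter.1 hB
      obtain ⟨hB3, hB4⟩ := hE_mem B hB1
      exact ⟨hB3, filter_mem_spreadSets hB4 (by omega), hB2⟩
  have hnum : ∀ p : ℕ, (30300 : ℝ) ^ (p / 105) ≤ 1.104 ^ p := by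
    intro p
    calc (30300 : ℝ) ^ (p / 105) ≤ (1.104 ^ 105) ^ (p / 105) := by
          gcongr
          norm_num
      _ = 1.104 ^ (105 * (p / 105)) := by rw [pow_mul]
      _ ≤ 1.104 ^ p := pow_le_pow_right₀ (by norm_num) (Nat.mul_div_le _ _)
  set r : ℝ := 1.0302 * 1.104 / 1.23 with hr
  have hsum_p : ∀ k ∈ K, ∀ p ∈ Finset.Ico 106 (k + 1),
      (#((Finset.Icc (p - p / 105) (p + p / 105)).biUnion (bad k p)) : ℝ) ≤
        2 * 1.23 ^ 6 * #(spreadSets g n) * r ^ p := by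
    intro k hk p hp
    calc (#((Finset.Icc (p - p / 105) (p + p / 105)).biUnion (bad k p)) : ℝ)
        ≤ ∑ a ∈ Finset.Icc (p - p / 105) (p + p / 105), (#(bad k p a) : ℝ) := by
          exact_mod_cast Finset.card_biUnion_le
      _ ≤ #(Finset.Icc (p - p / 105) (p + p / 105)) •
          (2 * (1.23 ^ 6 / 1.23 ^ p * #(spreadSets g n)) * (1.0302 ^ p * 10100 ^ (p / 105))) :=
          Finset.sum_le_card_nsmul _ _ _ (hbad k hk p hp)
      _ ≤ 3 ^ (p / 105) *
          (2 * (1.23 ^ 6 / 1.23 ^ p * #(spreadSets g n)) * (1.0302 ^ p * 10100 ^ (p / 105))) := by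
          rw [nsmul_eq_mul]
          gcongr
          rw [Nat.card_Icc]
          have := two_mul_add_one_le_three_pow (p / 105)
          exact_mod_cast (show p + p / 105 + 1 - (p - p / 105) ≤ 3 ^ (p / 105) by omega)
      _ = 2 * 1.23 ^ 6 * #(spreadSets g n) * ((1.0302 ^ p * 30300 ^ (p / 105)) / 1.23 ^ p) := by
          rw [show (30300 : ℝ) = 3 * 10100 by norm_num, mul_pow]
          ring
      _ ≤ 2 * 1.23 ^ 6 * #(spreadSets g n) * ((1.0302 ^ p * 1.104 ^ p) / 1.23 ^ p) := by
          gcongr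
          exact hnum p
      _ = _ := by rw [hr, div_pow, mul_pow]
  have hsum_k : ∀ k ∈ K, (#((Finset.Ico 106 (k + 1)).biUnion
      fun p => (Finset.Icc (p - p / 105) (p + p / 105)).biUnion (bad k p)) : ℝ) ≤
        2 * 1.23 ^ 6 * #(spreadSets g n) * (r ^ 106 / (1 - r)) := by
    intro k hk
    calc (#((Finset.Ico 106 (k + 1)).biUnion
          fun p => (Finset.Icc (p - p / 105) (p + p / 105)).biUnion (bad k p)) : ℝ)
        ≤ ∑ p ∈ Finset.Ico 106 (k + 1),
          (#((Finset.Icc (p - p / 105) (p + p / 105)).biUnion (bad k p)) : ℝ) := by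
          exact_mod_cast Finset.card_biUnion_le
      _ ≤ ∑ p ∈ Finset.Ico 106 (k + 1), 2 * 1.23 ^ 6 * #(spreadSets g n) * r ^ p :=
          Finset.sum_le_sum (hsum_p k hk)
      _ = 2 * 1.23 ^ 6 * #(spreadSets g n) * ∑ p ∈ Finset.Ico 106 (k + 1), r ^ p := by
          rw [Finset.mul_sum]
      _ ≤ _ := by
          gcongr
          exact geom_sum_Ico_le_of_lt_one (by positivity) (by rw [hr]; norm_num)
  have htotal : (#E : ℝ) ≤ #(spreadSets g (n + 1)) +
      3 * (2 * 1.23 ^ 6 * #(spreadSets g n) * (r ^ 106 / (1 - r))) := by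
    have h1 := (Finset.card_le_card hcover).trans (Finset.card_union_le _ _)
    have h2 : (#(K.biUnion fun k => (Finset.Ico 106 (k + 1)).biUnion
        fun p => (Finset.Icc (p - p / 105) (p + p / 105)).biUnion (bad k p)) : ℝ) ≤
        ∑ k ∈ K, (#((Finset.Ico 106 (k + 1)).biUnion
          fun p => (Finset.Icc (p - p / 105) (p + p / 105)).biUnion (bad k p)) : ℝ) := by
      exact_mod_cast Finset.card_biUnion_le
    have h3 := Finset.sum_le_card_nsmul _ _ _ hsum_k
    have hK : #K = 3 := by simp [K]
    rw [hK, nsmul_eq_mul] at h3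
    have h4 : (#E : ℝ) ≤ #(spreadSets g (n + 1)) + #(K.biUnion fun k =>
        (Finset.Ico 106 (k + 1)).biUnion
          fun p => (Finset.Icc (p - p / 105) (p + p / 105)).biUnion (bad k p)) := by
      exact_mod_cast h1
    push_cast at h3
    linarith
  -- The factor 3 counts the possible ends k in the new block. The total loss must fit into the gap
  -- between doubling and growth by 1.23 ^ 3.
  have hfinal : 3 * (2 * 1.23 ^ 6 * (r ^ 106 / (1 - r))) ≤ 2 - (1.23 : ℝ) ^ 3 := by
    rw [hr]
    norm_num
  have := mul_le_mul_of_nonneg_right hfinal (Nat.cast_nonneg (α := ℝ) #(spreadSets g n))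
  rw [hE] at htotal
  push_cast at htotal
  linarith

/-! ### Passage to an infinite word and conclusion -/

/-- There is an infinite choice giving a word all of whose long consecutive factors are far apart. -/
theorem exists_isSpread {α : Type*} [DecidableEq α] {g : ℕ → Bool → α}
    (hg : ∀ t, ∃ m, m / 3 = t ∧ g m false ≠ g m true) :
    ∃ b : ℕ → Bool, ∀ m, IsSpread (choiceWord g b) m := by
  have hpos : ∀ n, (0 : ℝ) < #(spreadSets g n) := by
    intro n
    induction n with
    | zero =>
      have : ∅ ∈ spreadSets g 0 := by
        refine mem_spreadSets.2 ⟨by simp, ?_⟩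
        intro i j k hij hjk hk
        omega
      exact_mod_cast Finset.card_pos.2 ⟨_, this⟩
    | succ n ih => exact lt_of_lt_of_le (by positivity) (card_spreadSets_succ hg n)
  let C (n : ℕ) : Set (ℕ → Bool) := {b | IsSpread (choiceWord g b) (3 * n)}
  have hclosed : ∀ n, IsClosed (C n) := by
    intro n
    let π : (ℕ → Bool) → (Fin n → Bool) := fun b t => b t
    have hπ : Continuous π := by fun_prop
    -- Membership depends only on the first n bits, so the set is the preimage of a subset of a
    -- discrete space.
    have : C n = π ⁻¹' (π '' C n) := by
      refine Set.Subset.antisymm (Set.subset_preimage_image _ _) ?_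
      rintro b ⟨c, hc, hcb⟩
      refine IsSpread.congr hc fun s hs => ?_
      have := congrFun hcb ⟨s / 3, by omega⟩
      exact congrArg (g s) this
    rw [this]
    exact (isClosed_discrete _).preimage hπ
  obtain ⟨b, hb⟩ := IsCompact.nonempty_iInter_of_sequence_nonempty_isCompact_isClosed C
    (fun n b hb => IsSpread.mono hb (by omega)) (fun n => by
      obtain ⟨B, hB⟩ := Finset.card_pos.1 (Nat.cast_pos.1 (hpos n))
      exact ⟨_, (mem_spreadSets.1 hB).2⟩) (hclosed 0).isCompact hclosed
  exact ⟨b, fun m => IsSpread.mono (Set.mem_iInter.1 hb m) (by omega)⟩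

theorem mainTheorem5 :
    (∃ w : ℕ → Fin 4, IsSynchronizationString (0.999606 : ℝ) w) ∧
      (∃ b : ℕ → Fin 2, IsWeakSynchronizationString (0.995268 : ℝ) b) := by
  constructor
  · obtain ⟨b, hb⟩ := exists_isSpread (g := insertionChoice) fun t => by
      refine ⟨3 * t + 1, by omega, ?_⟩
      simp [insertionChoice, Nat.add_mod, (ternaryThue_ne_three _).symm]
    refine ⟨choiceWord insertionChoice b, fun i j k hij hjk => ?_⟩
    have hki : ((k - i : ℕ) : ℝ) = (k : ℝ) - i := Nat.cast_sub (by omega)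
    rw [← hki]
    -- Below length 212 the required bound is less than 1, so it suffices that the factors differ.
    rcases Nat.lt_or_ge (k - i) 212 with hl | hl
    · have hpos : 0 < editDist (factor (choiceWord insertionChoice b) i j)
          (factor (choiceWord insertionChoice b) j k) := by
        by_contra! h0
        rw [Nat.le_zero] at h0
        have hlen := length_le_add_editDist (factor (choiceWord insertionChoice b) i j)
          (factor (choiceWord insertionChoice b) j k)
        refine choiceWord_insertionChoice_square_free b i (j - i) (by omega) fun s hs => ?_
        have := eq_of_editDist_eq_zero h0 s hs (by omega)
        rwa [show i + (j - i) = j by omega]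
      have h1 : (1 : ℝ) ≤ editDist (factor (choiceWord insertionChoice b) i j)
          (factor (choiceWord insertionChoice b) j k) := by exact_mod_cast hpos
      have h2 : ((k - i : ℕ) : ℝ) < 212 := by exact_mod_cast hl
      linarith
    · have h1 : ((k - i : ℕ) : ℝ) ≤ 211 * editDist (factor (choiceWord insertionChoice b) i j)
          (factor (choiceWord insertionChoice b) j k) := by
        exact_mod_cast hb k i j k hij hjk le_rfl hl
      have h2 : (212 : ℝ) ≤ (k - i : ℕ) := by exact_mod_cast hl
      linarith
  · obtain ⟨b, hb⟩ := exists_isSpread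
      (g := fun m c => if m % 3 = 0 ∧ c = true then (1 : Fin 2) else 0) fun t =>
        ⟨3 * t, by omega, by simp⟩
    refine ⟨choiceWord (fun m c => if m % 3 = 0 ∧ c = true then 1 else 0) b, fun i j k hij hjk hl => ?_⟩
    have hki : ((k - i : ℕ) : ℝ) = (k : ℝ) - i := Nat.cast_sub (by omega)
    rw [← hki] at hl ⊢
    -- Since 1 / 0.004732 exceeds 211, the integer length is at least 212; and 0.004732 is below 1 /
    -- 211.
    have hl' : (211 : ℝ) < (k - i : ℕ) := lt_of_lt_of_le (by norm_num) hl
    have h1 := hb k i j k hij hjk le_rfl (by exact_mod_cast hl')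
    have h2 := (Nat.cast_le (α := ℝ)).2 h1
    push_cast at h2
    linarith
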